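/- Let $E=(E^0,E^1,r,s)$ be an arbitrary directed graph (no restriction on the number of vertices or of edges) and let $K$ be any field. The Leavitt path algebra $L_K(E)$ is the associative, not necessarily unital, $K$-algebra generated by pairwise orthogonal idempotents $v$ ($v\in E^0$) and elements $e,e^*$ ($e\in E^1$) subject to the relations $s(e)e=e=e\,r(e)$ and $r(e)e^*=e^*=e^*s(e)$ for all $e\in E^1$; $e^*e=r(e)$ for all $e \in E^1$, and $e^*f=0$ for all $e\neq f$ in $E^1$; and $v=\sum_{s(e)=v}ee^*$ for every $v\in E^0$ such that $s^{-1}(v)$ is finite and non-empty. A ring $R$ (not necessarily unital) is a Zorn ring if for every $a\in R$ either $a$ is nilpotent or there is $b\in R$ such that $ab$ is a non-zero idempotent. A simple closed path is a sequence of edges $e_1\dots e_n$, $n\ge 1$, with $r(e_i)=s(e_{i+1})$ for $1\le i<n$, $r(e_n)=s(e_1)$, and $s(e_i)\ne s(e_1)$ for $2\le i\le n$; an exit for it is an edge $f$ such that $s(f)=s(e_i)$ and $f\neq e_i$ for some $i$. The graph $E$ satisfies Condition (L) if every simple closed path in $E$ has an exit. **Theorem 1.** The following are equivalent: (i) $L_K(E)$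 is a Zorn ring. (ii) Every non-zero one-sided (left or right) ideal of $L_K(E)$ contains a non-zero idempotent. (ii$_r$) Every non-zero right ideal of $L_K(E)$ contains a non-zero idempotent. (ii$_l$) Every non-zero left ideal of $L_K(E)$ contains a non-zero idempotent. (iii) For every non-zero $a\in L_K(E)$ there is a non-zero $b\in L_K(E)$ such that $bab=b$. (iv) $E$ satisfies Condition (L). -/

import Mathlib

/-- A directed graph `(V, E, r, s)` with vertex set `V` and edge set `E`, both arbitrary. -/
structure DirectedGraph (V E : Type*) where
  /-- the source of an edge -/
  s : E → V
  /-- the range of an edge -/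
  r : E → V

namespace DirectedGraph

variable {V E : Type*} (G : DirectedGraph V E)

/-- A vertex is regular if it emits at least one and only finitely many edges. -/
def IsRegularVertex (v : V) : Prop :=
  {e : E | G.s e = v}.Finite ∧ {e : E | G.s e = v}.Nonempty

/-- The edges `e 0, …, e n` (in this order) form a path; its length is `n + 1 ≥ 1`. -/
def IsPath {n : ℕ} (e : Fin (n + 1) → E) : Prop :=
  ∀ i : Fin n, G.r (e i.castSucc) = G.s (e i.succ)

/-- A closed path: the range of the last edge is the source of the first one (the base). -/
def IsClosedPath {n : ℕ} (e : Fin (n + 1) → E) : Prop :=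
  G.IsPath e ∧ G.r (e (Fin.last n)) = G.s (e 0)

/-- A simple closed path: a closed path that does not pass through its base more than once. -/
def IsSimpleClosedPath {n : ℕ} (e : Fin (n + 1) → E) : Prop :=
  G.IsClosedPath e ∧ ∀ i : Fin (n + 1), i ≠ 0 → G.s (e i) ≠ G.s (e 0)

/-- An exit for `e 0, …, e n` is an edge `f` such that `f` and `e i` are different edges with
the same source, for some `i`. -/
def IsExit {n : ℕ} (e : Fin (n + 1) → E) (f : E) : Prop :=
  ∃ i : Fin (n + 1), G.s f = G.s (e i) ∧ f ≠ e i

/-- Condition (L): every simple closed path has an exit. -/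
def ConditionL : Prop :=
  ∀ (n : ℕ) (e : Fin (n + 1) → E), G.IsSimpleClosedPath e → ∃ f : E, G.IsExit e f

end DirectedGraph

/-- The generators of the Leavitt path algebra: vertices, edges and ghost edges. -/
inductive LeavittGen (V E : Type*)
  | vertex (v : V) : LeavittGen V E
  | edge (e : E) : LeavittGen V E
  | ghost (e : E) : LeavittGen V E

/-- The free associative (non-unital) `K`-algebra on the vertices, edges and ghost edges. -/
abbrev LeavittFree (K V E : Type*) [Field K] : Type _ :=
  MonoidAlgebra K (FreeSemigroup (LeavittGen V E))

namespace LeavittFree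

variable (K : Type*) [Field K] {V E : Type*}

/-- A generator, as an element of the free algebra. -/
noncomputable def gen (x : LeavittGen V E) : LeavittFree K V E :=
  MonoidAlgebra.single (FreeSemigroup.of x) 1

/-- The generator `v`. -/
noncomputable def vertex (v : V) : LeavittFree K V E := gen K (.vertex v)

/-- The generator `e`. -/
noncomputable def edge (e : E) : LeavittFree K V E := gen K (.edge e)

/-- The generator `e*`. -/
noncomputable def ghost (e : E) : LeavittFree K V E := gen K (.ghost e)

end LeavittFree

open LeavittFree in
/-- The defining relations of the Leavitt path algebra, together with their scalar multiples
(the free algebra has no unit, so a ring congruence need not be stable under scalars unless the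
relations that generate it are). -/
inductive LeavittRel {V E : Type*} (G : DirectedGraph V E) (K : Type*) [Field K] :
    LeavittFree K V E → LeavittFree K V E → Prop
  | vertex_mul_self (v : V) : LeavittRel G K (vertex K v * vertex K v) (vertex K v)
  | vertex_mul_vertex (v w : V) (h : v ≠ w) : LeavittRel G K (vertex K v * vertex K w) 0
  | source_mul_edge (e : E) : LeavittRel G K (vertex K (G.s e) * edge K e) (edge K e)
  | edge_mul_range (e : E) : LeavittRel G K (edge K e * vertex K (G.r e)) (edge K e)
  | range_mul_ghost (e : E) : LeavittRel G K (vertex K (G.r e) * ghost K e) (ghost K e)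
  | ghost_mul_source (e : E) : LeavittRel G K (ghost K e * vertex K (G.s e)) (ghost K e)
  | ghost_mul_self (e : E) : LeavittRel G K (ghost K e * edge K e) (vertex K (G.r e))
  | ghost_mul_edge (e f : E) (h : e ≠ f) : LeavittRel G K (ghost K e * edge K f) 0
  | regular (v : V) (h : G.IsRegularVertex v) :
      LeavittRel G K (vertex K v) (∑ e ∈ h.1.toFinset, edge K e * ghost K e)
  | smul (k : K) (x y : LeavittFree K V E) (h : LeavittRel G K x y) :
      LeavittRel G K (k • x) (k • y)

/-- The Leavitt path algebra `L_K(G)`: the free non-unital `K`-algebra on the vertices, edges and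
ghost edges, modulo the ideal generated by the defining relations. -/
def LeavittPathAlgebra {V E : Type*} (G : DirectedGraph V E) (K : Type*) [Field K] : Type _ :=
  (ringConGen (LeavittRel G K)).Quotient

namespace LeavittPathAlgebra

variable {V E : Type*} (G : DirectedGraph V E) (K : Type*) [Field K]

noncomputable instance : NonUnitalRing (LeavittPathAlgebra G K) :=
  inferInstanceAs (NonUnitalRing (ringConGen (LeavittRel G K)).Quotient)

/-- The quotient map from the free algebra. -/
noncomputable def mk : LeavittFree K V E →ₙ+* LeavittPathAlgebra G K where
  toFun x := (x : (ringConGen (LeavittRel G K)).Quotient)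
  map_mul' _ _ := rfl
  map_zero' := rfl
  map_add' _ _ := rfl

theorem con_smul (k : K) {x y : LeavittFree K V E} (h : ringConGen (LeavittRel G K) x y) :
    ringConGen (LeavittRel G K) (k • x) (k • y) := by
  have h' : RingConGen.Rel (LeavittRel G K) x y := h
  clear h
  induction h' with
  | of x y h => exact RingConGen.Rel.of _ _ (LeavittRel.smul k x y h)
  | refl x => exact RingConGen.Rel.refl _
  | symm _ ih => exact RingConGen.Rel.symm ih
  | trans _ _ ih₁ ih₂ => exact RingConGen.Rel.trans ih₁ ih₂
  | add _ _ ih₁ ih₂ => simpa only [smul_add] using (ringConGen (LeavittRel G K)).add ih₁ ih₂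
  | mul _ h₂ ih₁ _ => simpa only [smul_mul_assoc] using (ringConGen (LeavittRel G K)).mul ih₁ h₂

noncomputable instance : SMul K (LeavittPathAlgebra G K) where
  smul k := Quotient.map' (k • ·) fun _ _ h => con_smul G K k h

theorem mk_surjective : Function.Surjective (mk G K) := Quotient.mk''_surjective

theorem mk_smul (k : K) (x : LeavittFree K V E) : mk G K (k • x) = k • mk G K x := rfl

noncomputable instance : Module K (LeavittPathAlgebra G K) :=
  Function.Surjective.module K (mk G K : LeavittFree K V E →+ LeavittPathAlgebra G K)
    (mk_surjective G K) (mk_smul G K)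

instance : IsScalarTower K (LeavittPathAlgebra G K) (LeavittPathAlgebra G K) where
  smul_assoc k a b := by
    obtain ⟨x, rfl⟩ := mk_surjective G K a
    obtain ⟨y, rfl⟩ := mk_surjective G K b
    simp only [smul_eq_mul, ← mk_smul, ← map_mul, smul_mul_assoc]

instance : SMulCommClass K (LeavittPathAlgebra G K) (LeavittPathAlgebra G K) where
  smul_comm k a b := by
    obtain ⟨x, rfl⟩ := mk_surjective G K a
    obtain ⟨y, rfl⟩ := mk_surjective G K b
    simp only [smul_eq_mul, ← mk_smul, ← map_mul, mul_smul_comm]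

end LeavittPathAlgebra

section RingNotions

variable (R : Type*) [NonUnitalRing R]

variable {R} in
/-- `powSucc a n` is the power `a ^ (n + 1)`, in a ring that need not have a unit. -/
def powSucc (a : R) : ℕ → R
  | 0 => a
  | n + 1 => powSucc a n * a

/-- A Zorn ring: each element `a` is nilpotent or has a `b` such that `a * b` is a non-zero
idempotent. -/
def IsZornRing : Prop :=
  ∀ a : R, (∃ n : ℕ, powSucc a n = 0) ∨ ∃ b : R, a * b ≠ 0 ∧ IsIdempotentElem (a * b)

variable {R} in
/-- A right ideal of a ring that need not have a unit. -/
def IsRightIdeal (I : AddSubgroup R) : Prop :=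
  ∀ a ∈ I, ∀ x : R, a * x ∈ I

variable {R} in
/-- A left ideal of a ring that need not have a unit. -/
def IsLeftIdeal (I : AddSubgroup R) : Prop :=
  ∀ a ∈ I, ∀ x : R, x * a ∈ I

end RingNotions

/-!
All conditions other than (L) follow from (iii) by the usual ring-theoretic remarks: if
`b a b = b ≠ 0`, then `a b` and `b a` are non-zero idempotents. So two facts about `L = L_K(G)`
carry the proof.

*Condition (L) implies (iii).* This is the Reduction Theorem (`exists_mul_mul_eq_smul_vtx`): for
`x ≠ 0` there are `p`, `q` with `p x q = k v`, `k ≠ 0`, `v` a vertex; then `b = k⁻¹ q v p` satisfies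
`b x b = b`. To obtain `p` and `q`, right multiplication by edges removes the ghost edges from `x`
without killing it (`exists_mul_mem_pathSpan`). Then left multiplication by the ghost of a shortest
path `l` in `x` and right multiplication by its range `v` leave `k v` plus finitely many closed
paths at `v`. Compressing by a path that follows a closed path and then leaves it through an exit
kills that closed path, and keeps the shape of the other terms (`exists_compress_sum_eq_zero`).

*If Condition (L) fails, so do (i), (ii_r) and (ii_l).* Let `v` be the base of a cycle `c` without
exits. Since `c c* = c* c = v`, the corner `v L v` is the Laurent polynomial ring in `c`
(`laurentHom_injective`, `exists_laurentHom_eq`), a domain in which `1 + T` is not a unit. Hence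
`a = v + c` is not nilpotent and no non-zero idempotent is of the form `a b` or `b a`
(`exists_forall_isIdempotentElem_eq_zero`).

Both parts need the paths to be linearly independent in `L`. This follows from a representation
(`rep`): choose an infinite set with self-injections indexed by the edges, such that the images of
the edges leaving a non-sink partition the set, and let the edges act by these injections, while a
degree counts their number. Different paths then move a basis vector to different basis vectors,
so the coefficient of a path is a matrix coefficient (`coef`).
-/

/-! ### Generators and relations -/

namespace LeavittPathAlgebra

section Relations

variable {V E : Type*} (G : DirectedGraph V E) (K : Type*) [Field K]

/-- The vertex `v`, as an element of `L_K(G)`. -/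
noncomputable def vtx (v : V) : LeavittPathAlgebra G K := mk G K (LeavittFree.vertex K v)

/-- The edge `e`, as an element of `L_K(G)`. -/
noncomputable def edg (e : E) : LeavittPathAlgebra G K := mk G K (LeavittFree.edge K e)

/-- The ghost edge `e*`, as an element of `L_K(G)`. -/
noncomputable def gst (e : E) : LeavittPathAlgebra G K := mk G K (LeavittFree.ghost K e)

variable {G K}

theorem mk_eq_of_rel {x y : LeavittFree K V E} (h : LeavittRel G K x y) :
    mk G K x = mk G K y :=
  Quotient.sound' (RingConGen.Rel.of _ _ h)

variable (G K)

theorem vtx_mul_self (v : V) : vtx G K v * vtx G K v = vtx G K v :=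
  (map_mul _ _ _).symm.trans (mk_eq_of_rel (.vertex_mul_self v))

variable {G K} in
theorem vtx_mul_of_ne {v w : V} (h : v ≠ w) : vtx G K v * vtx G K w = 0 :=
  (map_mul _ _ _).symm.trans ((mk_eq_of_rel (.vertex_mul_vertex v w h)).trans (map_zero _))

theorem vtx_mul_edg (e : E) : vtx G K (G.s e) * edg G K e = edg G K e :=
  (map_mul _ _ _).symm.trans (mk_eq_of_rel (.source_mul_edge e))

theorem edg_mul_vtx (e : E) : edg G K e * vtx G K (G.r e) = edg G K e :=
  (map_mul _ _ _).symm.trans (mk_eq_of_rel (.edge_mul_range e))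

theorem vtx_mul_gst (e : E) : vtx G K (G.r e) * gst G K e = gst G K e :=
  (map_mul _ _ _).symm.trans (mk_eq_of_rel (.range_mul_ghost e))

theorem gst_mul_vtx (e : E) : gst G K e * vtx G K (G.s e) = gst G K e :=
  (map_mul _ _ _).symm.trans (mk_eq_of_rel (.ghost_mul_source e))

theorem gst_mul_edg (e : E) : gst G K e * edg G K e = vtx G K (G.r e) :=
  (map_mul _ _ _).symm.trans (mk_eq_of_rel (.ghost_mul_self e))

variable {G K} in
theorem gst_mul_edg_of_ne {e f : E} (h : e ≠ f) : gst G K e * edg G K f = 0 :=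
  (map_mul _ _ _).symm.trans ((mk_eq_of_rel (.ghost_mul_edge e f h)).trans (map_zero _))

theorem vtx_eq_sum (v : V) (h : G.IsRegularVertex v) :
    vtx G K v = ∑ e ∈ h.1.toFinset, edg G K e * gst G K e := by
  refine (mk_eq_of_rel (.regular v h)).trans ?_
  rw [map_sum]
  exact Finset.sum_congr rfl fun e _ => map_mul _ _ _

variable {G K}

theorem vtx_mul_edg_of_ne {v : V} {e : E} (h : v ≠ G.s e) : vtx G K v * edg G K e = 0 := by
  rw [← vtx_mul_edg, ← mul_assoc, vtx_mul_of_ne h, zero_mul]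

theorem gst_mul_vtx_of_ne {v : V} {e : E} (h : G.s e ≠ v) : gst G K e * vtx G K v = 0 := by
  rw [← gst_mul_vtx, mul_assoc, vtx_mul_of_ne h, mul_zero]

/-- Every element is a linear combination of words in the generators, so a property that holds
for `0` and for the generators, and is stable under sums, scalars and right multiplication by a
generator, holds everywhere. -/
theorem induction_gen {p : LeavittPathAlgebra G K → Prop} (zero : p 0)
    (vertex : ∀ v, p (vtx G K v)) (edge : ∀ e, p (edg G K e)) (ghost : ∀ e, p (gst G K e))
    (add : ∀ x y, p x → p y → p (x + y)) (smul : ∀ (k : K) x, p x → p (k • x))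
    (mul_vertex : ∀ x v, p x → p (x * vtx G K v)) (mul_edge : ∀ x e, p x → p (x * edg G K e))
    (mul_ghost : ∀ x e, p x → p (x * gst G K e)) (a : LeavittPathAlgebra G K) : p a := by
  have hgen (x : LeavittGen V E) : p (mk G K (LeavittFree.gen K x)) := by
    cases x with
    | vertex v => exact vertex v
    | edge e => exact edge e
    | ghost e => exact ghost e
  have hmul (y) (x : LeavittGen V E) (hy : p y) : p (y * mk G K (LeavittFree.gen K x)) := by
    cases x with
    | vertex v => exact mul_vertex y v hy
    | edge e => exact mul_edge y e hy
    | ghost e => exact mul_ghost y e hy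
  have hword (l : List (LeavittGen V E)) (y) (hy : p y) (x : LeavittGen V E) :
      p (y * mk G K (MonoidAlgebra.single ⟨x, l⟩ 1)) := by
    induction l generalizing y x with
    | nil => exact hmul y x hy
    | cons z l ih =>
      have : (MonoidAlgebra.single ⟨x, z :: l⟩ 1 : LeavittFree K V E)
          = LeavittFree.gen K x * MonoidAlgebra.single ⟨z, l⟩ 1 := by
        rw [LeavittFree.gen, MonoidAlgebra.single_mul_single, mul_one]
        rfl
      rw [this, map_mul, ← mul_assoc]
      exact ih _ (hmul y x hy) z
  have hmono (w : FreeSemigroup (LeavittGen V E)) : p (mk G K (MonoidAlgebra.single w 1)) := by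
    obtain ⟨x, l⟩ := w
    cases l with
    | nil => exact hgen x
    | cons z l =>
      have : (MonoidAlgebra.single ⟨x, z :: l⟩ 1 : LeavittFree K V E)
          = LeavittFree.gen K x * MonoidAlgebra.single ⟨z, l⟩ 1 := by
        rw [LeavittFree.gen, MonoidAlgebra.single_mul_single, mul_one]
        rfl
      rw [this, map_mul]
      exact hword l _ (hgen x) z
  obtain ⟨x, rfl⟩ := mk_surjective G K a
  induction x using MonoidAlgebra.induction_linear with
  | zero => rwa [map_zero]
  | add f g hf hg => rw [map_add]; exact add _ _ hf hg
  | single w k =>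
    have : (MonoidAlgebra.single w k : LeavittFree K V E) = k • MonoidAlgebra.single w 1 := by
      rw [MonoidAlgebra.smul_single, smul_eq_mul, mul_one]
    rw [this, mk_smul]
    exact smul _ _ (hmono w)

end Relations

end LeavittPathAlgebra

/-! ### A graded representation -/

/-- There is a family of injections `g e` of a non-empty set into itself such that, for every
vertex `v` that emits an edge, the set is the disjoint union of the images of the `g e` with
`s e = v`. -/
theorem DirectedGraph.exists_branching {V E : Type*} (G : DirectedGraph V E) :
    ∃ g : E → Option E × ℕ → Option E × ℕ,
      (∀ e f s t, G.s e = G.s f → g e s = g f t → e = f ∧ s = t) ∧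
      ∀ e s, ∃ f t, G.s f = G.s e ∧ g f t = s := by
  have key (v : V) (hv : Nonempty {e : E // G.s e = v}) :
      Nonempty ({e : E // G.s e = v} × (Option E × ℕ) ≃ Option E × ℕ) := by
    rw [← Cardinal.eq, Cardinal.mk_prod, Cardinal.lift_id, Cardinal.lift_id]
    -- `Option E × ℕ` is infinite and has at least as many elements as `E`.
    refine Cardinal.mul_eq_right (Cardinal.aleph0_le_mk _) ?_ (Cardinal.mk_ne_zero _)
    exact Cardinal.mk_le_of_injective (f := fun e => (some e.1, 0)) fun e f h => by
      simpa [Subtype.ext_iff] using h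
  let ψ (v : V) : {e : E // G.s e = v} × (Option E × ℕ) → Option E × ℕ := fun x =>
    (key v ⟨x.1⟩).some x
  have hψ (e : E) : Function.Bijective (ψ (G.s e)) :=
    (key (G.s e) ⟨e, rfl⟩).some.bijective
  refine ⟨fun e s => ψ (G.s e) (⟨e, rfl⟩, s), ?_, ?_⟩
  · intro e f s t hef h
    have aux (v : V) (hv : G.s f = v) : ψ (G.s f) (⟨f, rfl⟩, t) = ψ v (⟨f, hv⟩, t) := by
      subst hv; rfl
    change ψ (G.s e) (⟨e, rfl⟩, s) = ψ (G.s f) (⟨f, rfl⟩, t) at h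
    rw [aux _ hef.symm] at h
    simpa using (hψ e).1 h
  · intro e s
    obtain ⟨⟨⟨f, hf⟩, t⟩, h⟩ := (hψ e).2 s
    refine ⟨f, t, hf, ?_⟩
    rw [← h]
    clear h
    generalize G.s e = v at hf ⊢
    subst hf; rfl

namespace LeavittPathAlgebra

section Representation

variable {V E : Type*} (G : DirectedGraph V E) (K : Type*) [Field K]

/-- The basis of the representation: a vertex, a point of the branching set, and a degree. -/
abbrev RepBasis (V E : Type*) : Type _ := V × (Option E × ℕ) × ℤ

/-- A choice of injections as in `DirectedGraph.exists_branching`. -/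
noncomputable def branch : E → Option E × ℕ → Option E × ℕ := G.exists_branching.choose

variable {G} in
theorem branch_inj {e f : E} {s t : Option E × ℕ} (h : G.s e = G.s f)
    (h' : branch G e s = branch G f t) : e = f ∧ s = t :=
  G.exists_branching.choose_spec.1 e f s t h h'

theorem exists_branch_eq (e : E) (s : Option E × ℕ) :
    ∃ f t, G.s f = G.s e ∧ branch G f t = s :=
  G.exists_branching.choose_spec.2 e s

open scoped Classical in
/-- A vertex acts as the projection onto the basis vectors over it. -/
noncomputable def repVertex (v : V) : Module.End K (RepBasis V E →₀ K) :=
  Finsupp.linearCombination K fun x => if x.1 = v then .single x 1 else 0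

open scoped Classical in
/-- An edge moves the basis vectors over its range to its source, and raises the degree by one. -/
noncomputable def repEdge (e : E) : Module.End K (RepBasis V E →₀ K) :=
  Finsupp.linearCombination K fun x =>
    if x.1 = G.r e then .single (G.s e, branch G e x.2.1, x.2.2 + 1) 1 else 0

open scoped Classical in
/-- A ghost edge undoes the edge, and kills the basis vectors outside the image of the edge. -/
noncomputable def repGhost (e : E) : Module.End K (RepBasis V E →₀ K) :=
  Finsupp.linearCombination K fun x =>
    if h : x.1 = G.s e ∧ ∃ t, branch G e t = x.2.1 then .single (G.r e, h.2.choose, x.2.2 - 1) 1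
    else 0

open scoped Classical in
theorem repVertex_single (v : V) (x : RepBasis V E) :
    repVertex K v (.single x 1) = if x.1 = v then .single x 1 else 0 := by
  simp [repVertex]

open scoped Classical in
theorem repEdge_single (e : E) (x : RepBasis V E) :
    repEdge G K e (.single x 1) =
      if x.1 = G.r e then .single (G.s e, branch G e x.2.1, x.2.2 + 1) 1 else 0 := by
  simp [repEdge]

theorem repGhost_single_branch (e : E) (t : Option E × ℕ) (n : ℤ) :
    repGhost G K e (.single (G.s e, branch G e t, n) 1) = .single (G.r e, t, n - 1) 1 := by
  have h : G.s e = G.s e ∧ ∃ t', branch G e t' = branch G e t := ⟨rfl, t, rfl⟩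
  have h' : h.2.choose = t := (branch_inj rfl h.2.choose_spec).2
  simp only [repGhost, Finsupp.linearCombination_single, one_smul]
  rw [dif_pos h, h']

variable {G} in
theorem repGhost_single_eq_zero {e : E} {x : RepBasis V E}
    (h : ¬ (x.1 = G.s e ∧ ∃ t, branch G e t = x.2.1)) :
    repGhost G K e (.single x 1) = 0 := by
  simp only [repGhost, Finsupp.linearCombination_single, one_smul]
  rw [dif_neg h]

theorem repGhost_cases (e : E) (x : RepBasis V E) :
    (∃ t n, x = (G.s e, branch G e t, n)) ∨ repGhost G K e (.single x 1) = 0 := by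
  by_cases h : x.1 = G.s e ∧ ∃ t, branch G e t = x.2.1
  · obtain ⟨h₁, t, ht⟩ := h
    exact .inl ⟨t, x.2.2, by rw [ht, ← h₁]⟩
  · exact .inr (repGhost_single_eq_zero K h)

/-- The representation, on the free algebra. -/
noncomputable def repFree : LeavittFree K V E →ₙₐ[K] Module.End K (RepBasis V E →₀ K) :=
  MonoidAlgebra.liftMagma K (FreeSemigroup.lift fun
    | .vertex v => repVertex K v
    | .edge e => repEdge G K e
    | .ghost e => repGhost G K e)

theorem repFree_vertex (v : V) : repFree G K (LeavittFree.vertex K v) = repVertex K v := by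
  simp [repFree, LeavittFree.vertex, LeavittFree.gen]

theorem repFree_edge (e : E) : repFree G K (LeavittFree.edge K e) = repEdge G K e := by
  simp [repFree, LeavittFree.edge, LeavittFree.gen]

theorem repFree_ghost (e : E) : repFree G K (LeavittFree.ghost K e) = repGhost G K e := by
  simp [repFree, LeavittFree.ghost, LeavittFree.gen]

theorem repFree_eq_of_rel {x y : LeavittFree K V E} (h : LeavittRel G K x y) :
    repFree G K x = repFree G K y := by
  induction h with
  | smul k x y _ ih => rw [map_smul, map_smul, ih]
  | vertex_mul_self v =>
    rw [map_mul, repFree_vertex]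
    refine Finsupp.lhom_ext' fun x => LinearMap.ext_ring ?_
    by_cases h : x.1 = v <;> simp [repVertex_single, h]
  | vertex_mul_vertex v w hvw =>
    rw [map_mul, map_zero, repFree_vertex, repFree_vertex]
    refine Finsupp.lhom_ext' fun x => LinearMap.ext_ring ?_
    by_cases h : x.1 = w
    · simp [repVertex_single, h, hvw.symm]
    · simp [repVertex_single, h]
  | source_mul_edge e =>
    rw [map_mul, repFree_vertex, repFree_edge]
    refine Finsupp.lhom_ext' fun x => LinearMap.ext_ring ?_
    by_cases h : x.1 = G.r e <;> simp [repVertex_single, repEdge_single, h]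
  | edge_mul_range e =>
    rw [map_mul, repFree_vertex, repFree_edge]
    refine Finsupp.lhom_ext' fun x => LinearMap.ext_ring ?_
    by_cases h : x.1 = G.r e <;> simp [repVertex_single, repEdge_single, h]
  | range_mul_ghost e =>
    rw [map_mul, repFree_vertex, repFree_ghost]
    refine Finsupp.lhom_ext' fun x => LinearMap.ext_ring ?_
    rcases repGhost_cases G K e x with ⟨t, n, rfl⟩ | h
    · simp [repVertex_single, repGhost_single_branch]
    · simp [h]
  | ghost_mul_source e =>
    rw [map_mul, repFree_vertex, repFree_ghost]
    refine Finsupp.lhom_ext' fun x => LinearMap.ext_ring ?_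
    by_cases h : x.1 = G.s e
    · simp [repVertex_single, h]
    · have := repGhost_single_eq_zero K (G := G) (e := e) (x := x) (fun h' => h h'.1)
      simp [repVertex_single, h, this]
  | ghost_mul_self e =>
    rw [map_mul, repFree_vertex, repFree_edge, repFree_ghost]
    refine Finsupp.lhom_ext' fun x => LinearMap.ext_ring ?_
    by_cases h : x.1 = G.r e
    · simp [repVertex_single, repEdge_single, h, repGhost_single_branch]
      rw [← h]
    · simp [repVertex_single, repEdge_single, h]
  | ghost_mul_edge e f hef =>
    rw [map_mul, map_zero, repFree_edge, repFree_ghost]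
    refine Finsupp.lhom_ext' fun x => LinearMap.ext_ring ?_
    by_cases h : x.1 = G.r f
    · have := repGhost_single_eq_zero K (G := G) (e := e)
        (x := (G.s f, branch G f x.2.1, x.2.2 + 1))
        (fun h' => hef (branch_inj h'.1.symm h'.2.choose_spec).1)
      simp [repEdge_single, h, this]
    · simp [repEdge_single, h]
  | regular v h =>
    rw [map_sum, repFree_vertex]
    simp only [map_mul, repFree_edge, repFree_ghost]
    refine Finsupp.lhom_ext' fun x => LinearMap.ext_ring ?_
    simp only [LinearMap.comp_apply, Finsupp.lsingle_apply, LinearMap.sum_apply,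
      Module.End.mul_apply]
    obtain ⟨e₀, he₀ : G.s e₀ = v⟩ := h.2
    obtain ⟨w, a, n⟩ := x
    by_cases hw : w = v
    · subst hw
      obtain ⟨f, t, hf, rfl⟩ := exists_branch_eq G e₀ a
      rw [he₀] at hf
      subst hf
      rw [Finset.sum_eq_single f]
      · simp [repVertex_single, repGhost_single_branch, repEdge_single]
      · intro e _ hef
        rw [repGhost_single_eq_zero, map_zero]
        exact fun h' => hef (branch_inj h'.1.symm h'.2.choose_spec).1
      · simp
    · rw [repVertex_single, if_neg hw, Finset.sum_eq_zero]
      intro e he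
      rw [repGhost_single_eq_zero, map_zero]
      rintro ⟨rfl, -⟩
      exact hw (by simpa using he)

/-- A representation of `L_K(G)`, graded by the last component of `RepBasis`. -/
noncomputable def rep : LeavittPathAlgebra G K →ₗ[K] Module.End K (RepBasis V E →₀ K) where
  toFun := Quotient.lift (repFree G K) fun x y h => by
    have h' : RingConGen.Rel (LeavittRel G K) x y := h
    clear h
    induction h' with
    | of x y h => exact repFree_eq_of_rel G K h
    | refl x => rfl
    | symm _ ih => exact ih.symm
    | trans _ _ ih₁ ih₂ => exact ih₁.trans ih₂
    | add _ _ ih₁ ih₂ => rw [map_add, map_add, ih₁, ih₂]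
    | mul _ _ ih₁ ih₂ => rw [map_mul, map_mul, ih₁, ih₂]
  map_add' a b := by
    obtain ⟨x, rfl⟩ := mk_surjective G K a
    obtain ⟨y, rfl⟩ := mk_surjective G K b
    exact map_add (repFree G K) x y
  map_smul' k a := by
    obtain ⟨x, rfl⟩ := mk_surjective G K a
    exact map_smul (repFree G K) k x

theorem rep_mul (a b : LeavittPathAlgebra G K) : rep G K (a * b) = rep G K a * rep G K b := by
  obtain ⟨x, rfl⟩ := mk_surjective G K a
  obtain ⟨y, rfl⟩ := mk_surjective G K b
  exact map_mul (repFree G K) x y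

theorem rep_vtx (v : V) : rep G K (vtx G K v) = repVertex K v := repFree_vertex G K v

theorem rep_edg (e : E) : rep G K (edg G K e) = repEdge G K e := repFree_edge G K e

end Representation

end LeavittPathAlgebra

/-! ### Paths and their linear independence -/

namespace DirectedGraph

variable {V E : Type*} (G : DirectedGraph V E)

/-- The source of the path with list of edges `l` and range `w`; the range has to be given since
`l` may be empty. -/
def src : List E → V → V
  | [], w => w
  | e :: _, _ => G.s e

/-- The edges in the list `l` form, in this order, a path with range `w`. -/
def IsWalk : List E → V → Prop
  | [], _ => True
  | e :: l, w => G.r e = G.src l w ∧ IsWalk l w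

variable {G}

theorem src_append (l l' : List E) (w : V) : G.src (l ++ l') w = G.src l (G.src l' w) := by
  cases l <;> rfl

theorem isWalk_append {l l' : List E} {w : V} :
    G.IsWalk (l ++ l') w ↔ G.IsWalk l (G.src l' w) ∧ G.IsWalk l' w := by
  induction l with
  | nil => simp [IsWalk]
  | cons e l ih => simp [IsWalk, ih, src_append, and_assoc]

end DirectedGraph

namespace LeavittPathAlgebra

section Walk

variable {V E : Type*} (G : DirectedGraph V E) (K : Type*) [Field K]

/-- The element of `L_K(G)` given by the path with list of edges `l` and range `w`; it is zero if
there is no such path. -/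
noncomputable def walk (l : List E) (w : V) : LeavittPathAlgebra G K :=
  l.foldr (fun e x => edg G K e * x) (vtx G K w)

/-- The ghost path `p*`, for the path `p` with list of edges `l` and range `w`. -/
noncomputable def ghostWalk (l : List E) (w : V) : LeavittPathAlgebra G K :=
  l.foldr (fun e x => x * gst G K e) (vtx G K w)

theorem walk_nil (w : V) : walk G K [] w = vtx G K w := rfl

theorem walk_cons (e : E) (l : List E) (w : V) :
    walk G K (e :: l) w = edg G K e * walk G K l w := rfl

theorem ghostWalk_cons (e : E) (l : List E) (w : V) :
    ghostWalk G K (e :: l) w = ghostWalk G K l w * gst G K e := rfl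

theorem vtx_mul_walk (l : List E) (w : V) :
    vtx G K (G.src l w) * walk G K l w = walk G K l w := by
  cases l with
  | nil => exact vtx_mul_self G K w
  | cons e l => rw [walk_cons, ← mul_assoc]; exact congrArg (· * _) (vtx_mul_edg G K e)

theorem walk_mul_vtx (l : List E) (w : V) : walk G K l w * vtx G K w = walk G K l w := by
  induction l with
  | nil => exact vtx_mul_self G K w
  | cons e l ih => rw [walk_cons, mul_assoc, ih]

theorem ghostWalk_mul_vtx (l : List E) (w : V) :
    ghostWalk G K l w * vtx G K (G.src l w) = ghostWalk G K l w := by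
  cases l with
  | nil => exact vtx_mul_self G K w
  | cons e l => rw [ghostWalk_cons, mul_assoc]; exact congrArg (_ * ·) (gst_mul_vtx G K e)

variable {G K}

theorem vtx_mul_walk_of_ne {v : V} {l : List E} {w : V} (h : v ≠ G.src l w) :
    vtx G K v * walk G K l w = 0 := by
  rw [← vtx_mul_walk, ← mul_assoc, vtx_mul_of_ne h, zero_mul]

theorem walk_mul_vtx_of_ne {l : List E} {v w : V} (h : w ≠ v) :
    walk G K l w * vtx G K v = 0 := by
  rw [← walk_mul_vtx, mul_assoc, vtx_mul_of_ne h, mul_zero]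

theorem walk_eq_zero {l : List E} {w : V} (h : ¬ G.IsWalk l w) : walk G K l w = 0 := by
  induction l with
  | nil => exact absurd trivial h
  | cons e l ih =>
    by_cases hl : G.IsWalk l w
    · rw [walk_cons, ← edg_mul_vtx, mul_assoc, vtx_mul_walk_of_ne (fun he => h ⟨he, hl⟩), mul_zero]
    · rw [walk_cons, ih hl, mul_zero]

theorem walk_mul_walk {l l' : List E} {w w' : V} (h : w = G.src l' w') :
    walk G K l w * walk G K l' w' = walk G K (l ++ l') w' := by
  induction l with
  | nil => rw [h]; exact vtx_mul_walk G K l' w'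
  | cons e l ih => rw [walk_cons, mul_assoc, ih]; rfl

theorem walk_mul_walk_of_ne {l l' : List E} {w w' : V} (h : w ≠ G.src l' w') :
    walk G K l w * walk G K l' w' = 0 := by
  rw [← walk_mul_vtx, mul_assoc, vtx_mul_walk_of_ne h, mul_zero]

variable (G K) in
theorem walk_singleton (e : E) : walk G K [e] (G.r e) = edg G K e := edg_mul_vtx G K e

theorem walk_mul_edg (l : List E) (e : E) :
    walk G K l (G.s e) * edg G K e = walk G K (l ++ [e]) (G.r e) := by
  rw [← walk_singleton]
  exact walk_mul_walk rfl

theorem walk_mul_edg_of_ne {l : List E} {w : V} {e : E} (h : w ≠ G.s e) :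
    walk G K l w * edg G K e = 0 := by
  rw [← walk_singleton, walk_mul_walk_of_ne h]

theorem ghostWalk_mul_walk_self {l : List E} {w : V} (h : G.IsWalk l w) :
    ghostWalk G K l w * walk G K l w = vtx G K w := by
  induction l with
  | nil => exact vtx_mul_self G K w
  | cons e l ih =>
    rw [ghostWalk_cons, walk_cons, mul_assoc, ← mul_assoc (gst G K e), gst_mul_edg, h.1,
      vtx_mul_walk, ih h.2]

/-- For `p` not longer than `q`, the product `p* q` vanishes unless `p` is an initial segment of
`q`, in which case it is the rest of `q`. -/
theorem ghostWalk_mul_walk {l l' : List E} {w w' : V} (h : G.IsWalk l w)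
    (hlen : l.length ≤ l'.length) : ghostWalk G K l w * walk G K l' w' = 0 ∨
      ∃ l'', l' = l ++ l'' ∧
        ghostWalk G K l w * walk G K l' w' = vtx G K w * walk G K l'' w' := by
  induction l generalizing l' with
  | nil => exact .inr ⟨l', rfl, rfl⟩
  | cons e l ih =>
    cases l' with
    | nil => simp at hlen
    | cons f l' =>
      rw [ghostWalk_cons, walk_cons, mul_assoc, ← mul_assoc (gst G K e)]
      by_cases hef : e = f
      · subst hef
        rw [gst_mul_edg, ← mul_assoc, h.1, ghostWalk_mul_vtx]
        rcases ih h.2 (Nat.le_of_succ_le_succ hlen) with h0 | ⟨l'', rfl, hl''⟩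
        · exact .inl h0
        · exact .inr ⟨l'', rfl, hl''⟩
      · exact .inl (by rw [gst_mul_edg_of_ne hef, zero_mul, mul_zero])

/-- The action of the path `l` on the branching set. -/
noncomputable def branchWalk (G : DirectedGraph V E) (l : List E) (s : Option E × ℕ) :
    Option E × ℕ :=
  l.foldr (branch G) s

theorem branchWalk_inj {l l' : List E} {w : V} {s : Option E × ℕ} (hl : G.IsWalk l w)
    (hl' : G.IsWalk l' w) (hlen : l.length = l'.length) (hsrc : G.src l w = G.src l' w)
    (h : branchWalk G l s = branchWalk G l' s) : l = l' := by
  induction l generalizing l' with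
  | nil => exact (List.length_eq_zero_iff.1 hlen.symm).symm
  | cons e l ih =>
    cases l' with
    | nil => simp at hlen
    | cons f l' =>
      obtain ⟨rfl, h'⟩ := branch_inj hsrc h
      rw [ih hl.2 hl'.2 (Nat.succ_injective hlen) (hl.1.symm.trans hl'.1) h']

theorem rep_walk_single {l : List E} {w : V} (h : G.IsWalk l w) (s : Option E × ℕ) (n : ℤ) :
    rep G K (walk G K l w) (.single (w, s, n) 1) =
      .single (G.src l w, branchWalk G l s, n + l.length) 1 := by
  induction l with
  | nil => simp [walk_nil, rep_vtx, repVertex_single, DirectedGraph.src, branchWalk]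
  | cons e l ih =>
    rw [walk_cons, rep_mul, Module.End.mul_apply, ih h.2, rep_edg, repEdge_single, if_pos h.1.symm]
    simp [DirectedGraph.src, branchWalk, add_assoc]

theorem rep_walk_single_of_ne {l : List E} {v w : V} (h : v ≠ w) (s : Option E × ℕ) (n : ℤ) :
    rep G K (walk G K l w) (.single (v, s, n) 1) = 0 := by
  rw [← walk_mul_vtx, rep_mul, Module.End.mul_apply, rep_vtx, repVertex_single, if_neg h, map_zero]

variable (G K) in
/-- The coefficient of the path `q`: a linear functional on `L_K(G)` that takes the value `1` on
`q` and `0` on all other paths. It is a matrix coefficient of `rep`. -/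
noncomputable def coef (q : List E × V) : LeavittPathAlgebra G K →ₗ[K] K :=
  Finsupp.lapply (G.src q.1 q.2, branchWalk G q.1 (none, 0), (q.1.length : ℤ)) ∘ₗ
    LinearMap.applyₗ (Finsupp.single (q.2, (none, 0), 0) 1) ∘ₗ rep G K

theorem coef_walk_self {q : List E × V} (hq : G.IsWalk q.1 q.2) :
    coef G K q (walk G K q.1 q.2) = 1 := by
  simp [coef, rep_walk_single hq]

theorem coef_walk_of_ne {q q' : List E × V} (hq : G.IsWalk q.1 q.2) (h : q' ≠ q) :
    coef G K q (walk G K q'.1 q'.2) = 0 := by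
  obtain ⟨l, w⟩ := q
  obtain ⟨l', w'⟩ := q'
  by_cases hw : w = w'
  · subst hw
    by_cases hq' : G.IsWalk l' w
    · simp only [coef, LinearMap.comp_apply, LinearMap.applyₗ_apply_apply, rep_walk_single hq',
        Finsupp.lapply_apply]
      rw [Finsupp.single_eq_of_ne]
      intro he
      simp only [Prod.mk.injEq, zero_add, Nat.cast_inj] at he
      exact h (by rw [branchWalk_inj hq' hq he.2.2.symm he.1.symm he.2.1.symm])
    · rw [walk_eq_zero hq', map_zero]
  · simp [coef, rep_walk_single_of_ne hw]

variable (G K) in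
theorem vtx_ne_zero (v : V) : vtx G K v ≠ 0 := by
  intro h
  have := coef_walk_self (G := G) (K := K) (q := ([], v)) trivial
  rw [walk_nil, h, map_zero] at this
  exact zero_ne_one this

variable (G K) in
/-- The linear span of the paths, with the vertices as paths of length zero. -/
noncomputable def pathSpan : Submodule K (LeavittPathAlgebra G K) :=
  LinearMap.range (Finsupp.linearCombination K fun q : List E × V => walk G K q.1 q.2)

theorem walk_mem_pathSpan (l : List E) (w : V) : walk G K l w ∈ pathSpan G K :=
  ⟨.single (l, w) 1, by simp⟩

theorem pathSpan_induction {p : LeavittPathAlgebra G K → Prop} (zero : p 0)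
    (walk : ∀ l w, p (walk G K l w)) (add : ∀ x y, p x → p y → p (x + y))
    (smul : ∀ (k : K) x, p x → p (k • x)) {x : LeavittPathAlgebra G K} (hx : x ∈ pathSpan G K) :
    p x := by
  rw [pathSpan, Finsupp.range_linearCombination] at hx
  induction hx using Submodule.span_induction with
  | mem x h => obtain ⟨q, rfl⟩ := h; exact walk q.1 q.2
  | zero => exact zero
  | add x y _ _ hx hy => exact add x y hx hy
  | smul k x _ hx => exact smul k x hx

theorem pathSpan_mul_vtx {x : LeavittPathAlgebra G K} (hx : x ∈ pathSpan G K) (v : V) :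
    x * vtx G K v ∈ pathSpan G K := by
  refine pathSpan_induction (p := fun x => x * vtx G K v ∈ pathSpan G K) ?_ (fun l w => ?_)
    (fun x y hx hy => ?_) (fun k x hx => ?_) hx
  · rw [zero_mul]; exact zero_mem _
  · by_cases h : w = v
    · subst h; rw [walk_mul_vtx]; exact walk_mem_pathSpan l w
    · rw [walk_mul_vtx_of_ne h]; exact zero_mem _
  · rw [add_mul]; exact add_mem hx hy
  · rw [smul_mul_assoc]; exact Submodule.smul_mem _ _ hx

theorem pathSpan_mul_edg {x : LeavittPathAlgebra G K} (hx : x ∈ pathSpan G K) (e : E) :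
    x * edg G K e ∈ pathSpan G K := by
  refine pathSpan_induction (p := fun x => x * edg G K e ∈ pathSpan G K) ?_ (fun l w => ?_)
    (fun x y hx hy => ?_) (fun k x hx => ?_) hx
  · rw [zero_mul]; exact zero_mem _
  · by_cases h : w = G.s e
    · subst h; rw [walk_mul_edg]; exact walk_mem_pathSpan _ _
    · rw [walk_mul_edg_of_ne h]; exact zero_mem _
  · rw [add_mul]; exact add_mem hx hy
  · rw [smul_mul_assoc]; exact Submodule.smul_mem _ _ hx

/-- Right multiplication by an edge `e` is injective on the combinations of paths that end at the
source of `e`. -/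
theorem mul_vtx_eq_zero_of_mul_edg_eq_zero {x : LeavittPathAlgebra G K}
    (hx : x ∈ pathSpan G K) {e : E} (h : x * edg G K e = 0) : x * vtx G K (G.s e) = 0 := by
  obtain ⟨k, rfl⟩ := hx
  rw [Finsupp.linearCombination_apply, Finsupp.sum, Finset.sum_mul] at h ⊢
  refine Finset.sum_eq_zero fun q _ => ?_
  obtain ⟨l, w⟩ := q
  by_cases hw : w = G.s e
  swap
  · rw [smul_mul_assoc, walk_mul_vtx_of_ne hw, smul_zero]
  subst hw
  by_cases hl : G.IsWalk l (G.s e)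
  swap
  · rw [walk_eq_zero hl, smul_zero, zero_mul]
  have hle : G.IsWalk (l ++ [e]) (G.r e) := DirectedGraph.isWalk_append.2 ⟨hl, rfl, trivial⟩
  have h' := congrArg (coef G K (l ++ [e], G.r e)) h
  rw [map_sum, map_zero, Finset.sum_eq_single (l, G.s e)] at h'
  · rw [smul_mul_assoc, walk_mul_edg, map_smul, coef_walk_self (q := (l ++ [e], G.r e)) hle,
      smul_eq_mul, mul_one] at h'
    rw [h', zero_smul, zero_mul]
  · rintro ⟨l', w'⟩ _ hne
    by_cases hw' : w' = G.s e
    · subst hw'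
      rw [smul_mul_assoc, walk_mul_edg, map_smul, coef_walk_of_ne (q := (l ++ [e], G.r e))
        (q' := (l' ++ [e], G.r e)) hle, smul_zero]
      intro h0
      exact hne (by simpa using h0)
    · rw [smul_mul_assoc, walk_mul_edg_of_ne hw', smul_zero, map_zero]
  · intro h0
    rw [Finsupp.notMem_support_iff.1 h0, zero_smul, zero_mul, map_zero]

end Walk

end LeavittPathAlgebra

/-! ### Condition (L) and closed paths -/

namespace DirectedGraph

variable {V E : Type*} {G : DirectedGraph V E}

theorem s_getElem (l : List E) (w : V) (i : ℕ) (h : i < l.length) :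
    G.s l[i] = G.src (l.drop i) w := by
  rw [List.drop_eq_getElem_cons h]; rfl

theorem IsWalk.r_getElem {l : List E} {w : V} (hl : G.IsWalk l w) (i : ℕ) (h : i < l.length) :
    G.r l[i] = G.src (l.drop (i + 1)) w := by
  rw [← List.take_append_drop i l, isWalk_append, List.drop_eq_getElem_cons h] at hl
  exact hl.2.1

/-- Under Condition (L), every closed path, simple or not, has an exit: a part of it up to its
first return to the base is a simple closed path. -/
theorem ConditionL.exists_exit (hL : G.ConditionL) {p : List E} {v : V} (hc : p ≠ [])
    (hw : G.IsWalk p v) (hv : G.src p v = v) :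
    ∃ l₁ e l₂ f, p = l₁ ++ e :: l₂ ∧ G.s f = G.s e ∧ f ≠ e := by
  have hex : ∃ m, m < p.length ∧ G.src (p.drop (m + 1)) v = v := by
    have := List.length_pos_iff.2 hc
    exact ⟨p.length - 1, by omega, by rw [List.drop_of_length_le (by omega)]; rfl⟩
  classical
  obtain ⟨hm, hmv⟩ := Nat.find_spec hex
  have hmin (i : ℕ) := Nat.find_min hex (m := i)
  generalize Nat.find hex = m at hm hmv hmin
  have hlt (i : Fin (m + 1)) : (i : ℕ) < p.length := lt_of_lt_of_le i.2 hm
  have hs (i : Fin (m + 1)) := s_getElem (G := G) p v i (hlt i)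
  have h0 : G.s (p[((0 : Fin (m + 1)) : ℕ)]'(hlt 0)) = v := (hs 0).trans hv
  obtain ⟨f, i, hf, hne⟩ := hL m (fun i => p[(i : ℕ)]'(hlt i)) (by
    refine ⟨⟨fun i => ?_, ?_⟩, fun i hi => ?_⟩
    · exact (hw.r_getElem _ _).trans (s_getElem p v (i + 1) (hlt i.succ)).symm
    · rw [h0]
      exact (hw.r_getElem m hm).trans hmv
    · rw [h0, hs]
      have hi' : (i : ℕ) ≠ 0 := fun h => hi (Fin.ext h)
      have hi2 := i.2
      intro h
      refine hmin (i - 1) (by omega) ⟨by omega, ?_⟩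
      rwa [Nat.sub_add_cancel (by omega)])
  refine ⟨p.take i, p[(i : ℕ)]'(hlt i), p.drop (i + 1), f, ?_, hf, hne⟩
  rw [← List.drop_eq_getElem_cons, List.take_append_drop]

end DirectedGraph

namespace LeavittPathAlgebra

section Reduction

variable {V E : Type*} {G : DirectedGraph V E} {K : Type*} [Field K]

/-! ### Reduction to combinations of paths -/

/-- An element is not annihilated by all vertices, unless it is zero: finite sums of vertices are
local units. -/
theorem exists_mul_vtx_ne_zero {x : LeavittPathAlgebra G K} (hx : x ≠ 0) :
    ∃ v, x * vtx G K v ≠ 0 := by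
  classical
  have key : ∃ s : Finset V, ∀ t, s ⊆ t → x * ∑ v ∈ t, vtx G K v = x := by
    clear hx
    have hv (w : V) (t : Finset V) (ht : {w} ⊆ t) :
        vtx G K w * ∑ v ∈ t, vtx G K v = vtx G K w := by
      rw [Finset.mul_sum, Finset.sum_eq_single w, vtx_mul_self]
      · exact fun v _ hv => vtx_mul_of_ne hv.symm
      · exact fun h => absurd (ht (Finset.mem_singleton_self w)) h
    have he (e : E) (t : Finset V) (ht : {G.r e} ⊆ t) :
        edg G K e * ∑ v ∈ t, vtx G K v = edg G K e := by
      rw [← edg_mul_vtx, mul_assoc, hv _ t ht]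
    have hg (e : E) (t : Finset V) (ht : {G.s e} ⊆ t) :
        gst G K e * ∑ v ∈ t, vtx G K v = gst G K e := by
      rw [← gst_mul_vtx, mul_assoc, hv _ t ht]
    induction x using induction_gen with
    | zero => exact ⟨∅, fun t _ => zero_mul _⟩
    | vertex w => exact ⟨_, hv w⟩
    | edge e => exact ⟨_, he e⟩
    | ghost e => exact ⟨_, hg e⟩
    | add x y hx hy =>
      obtain ⟨s, hs⟩ := hx
      obtain ⟨s', hs'⟩ := hy
      exact ⟨s ∪ s', fun t ht => by
        rw [add_mul, hs t (Finset.union_subset_left ht), hs' t (Finset.union_subset_right ht)]⟩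
    | smul k x hx =>
      obtain ⟨s, hs⟩ := hx
      exact ⟨s, fun t ht => by rw [smul_mul_assoc, hs t ht]⟩
    | mul_vertex x w _ => exact ⟨_, fun t ht => by rw [mul_assoc, hv w t ht]⟩
    | mul_edge x e _ => exact ⟨_, fun t ht => by rw [mul_assoc, he e t ht]⟩
    | mul_ghost x e _ => exact ⟨_, fun t ht => by rw [mul_assoc, hg e t ht]⟩
  by_contra! h
  obtain ⟨s, hs⟩ := key
  refine hx ?_
  rw [← hs s subset_rfl, Finset.mul_sum]
  exact Finset.sum_eq_zero fun v _ => h v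

variable (G K) in
/-- The span of the products `p q*` of paths, with `q` of length at most `n`. -/
noncomputable def ghostFiltration : ℕ → Submodule K (LeavittPathAlgebra G K)
  | 0 => pathSpan G K
  | n + 1 => pathSpan G K ⊔ ⨆ e, (ghostFiltration n).map (LinearMap.mulRight K (gst G K e))

theorem pathSpan_le_ghostFiltration (n : ℕ) : pathSpan G K ≤ ghostFiltration G K n := by
  cases n with
  | zero => exact le_rfl
  | succ n => exact le_sup_left

theorem ghostFiltration_mono : Monotone (ghostFiltration G K) := by
  refine monotone_nat_of_le_succ fun n => ?_
  induction n with
  | zero => exact pathSpan_le_ghostFiltration 1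
  | succ n ih => exact sup_le_sup_left (iSup_mono fun e => Submodule.map_mono ih) _

theorem mul_gst_mem_ghostFiltration {n : ℕ} {x : LeavittPathAlgebra G K}
    (hx : x ∈ ghostFiltration G K n) (e : E) : x * gst G K e ∈ ghostFiltration G K (n + 1) :=
  Submodule.mem_sup_right (Submodule.mem_iSup_of_mem e ⟨x, hx, rfl⟩)

theorem exists_of_mem_ghostFiltration_succ {n : ℕ} {x : LeavittPathAlgebra G K}
    (hx : x ∈ ghostFiltration G K (n + 1)) :
    ∃ β ∈ pathSpan G K, ∃ (s : Finset E) (b : E → LeavittPathAlgebra G K),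
      (∀ e, b e ∈ ghostFiltration G K n) ∧ x = β + ∑ e ∈ s, b e * gst G K e := by
  obtain ⟨β, hβ, y, hy, rfl⟩ := Submodule.mem_sup.1 hx
  obtain ⟨f, hf, rfl⟩ := (Submodule.mem_iSup_iff_exists_finsupp _ _).1 hy
  choose b hb hbf using hf
  exact ⟨β, hβ, f.support, b, hb, congrArg (β + ·) (Finset.sum_congr rfl fun e _ => (hbf e).symm)⟩

theorem mul_vtx_mem_ghostFiltration {n : ℕ} {x : LeavittPathAlgebra G K}
    (hx : x ∈ ghostFiltration G K n) (v : V) : x * vtx G K v ∈ ghostFiltration G K n := by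
  cases n with
  | zero => exact pathSpan_mul_vtx hx v
  | succ n =>
    obtain ⟨β, hβ, s, b, hb, rfl⟩ := exists_of_mem_ghostFiltration_succ hx
    rw [add_mul, Finset.sum_mul]
    refine add_mem (pathSpan_le_ghostFiltration _ (pathSpan_mul_vtx hβ v))
      (sum_mem fun e _ => ?_)
    by_cases h : G.s e = v
    · rw [mul_assoc, ← h, gst_mul_vtx]
      exact mul_gst_mem_ghostFiltration (hb e) e
    · rw [mul_assoc, gst_mul_vtx_of_ne h, mul_zero]
      exact zero_mem _

theorem mul_edg_mem_ghostFiltration {n : ℕ} {x : LeavittPathAlgebra G K}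
    (hx : x ∈ ghostFiltration G K (n + 1)) (f : E) : x * edg G K f ∈ ghostFiltration G K n := by
  obtain ⟨β, hβ, s, b, hb, rfl⟩ := exists_of_mem_ghostFiltration_succ hx
  rw [add_mul, Finset.sum_mul]
  refine add_mem (pathSpan_le_ghostFiltration _ (pathSpan_mul_edg hβ f)) (sum_mem fun e _ => ?_)
  by_cases h : e = f
  · rw [mul_assoc, ← h, gst_mul_edg]
    exact mul_vtx_mem_ghostFiltration (hb e) _
  · rw [mul_assoc, gst_mul_edg_of_ne h, mul_zero]
    exact zero_mem _

theorem exists_mem_ghostFiltration (x : LeavittPathAlgebra G K) :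
    ∃ n, x ∈ ghostFiltration G K n := by
  have hv (v : V) : vtx G K v ∈ ghostFiltration G K 0 := walk_mem_pathSpan [] v
  induction x using induction_gen with
  | zero => exact ⟨0, zero_mem _⟩
  | vertex v => exact ⟨0, hv v⟩
  | edge e => exact ⟨0, walk_singleton G K e ▸ walk_mem_pathSpan [e] (G.r e)⟩
  | ghost e => exact ⟨1, vtx_mul_gst G K e ▸ mul_gst_mem_ghostFiltration (hv _) e⟩
  | add x y hx hy =>
    obtain ⟨m, hm⟩ := hx
    obtain ⟨n, hn⟩ := hy
    exact ⟨max m n, add_mem (ghostFiltration_mono (le_max_left m n) hm)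
      (ghostFiltration_mono (le_max_right m n) hn)⟩
  | smul k x hx =>
    obtain ⟨n, hn⟩ := hx
    exact ⟨n, Submodule.smul_mem _ _ hn⟩
  | mul_vertex x v hx =>
    obtain ⟨n, hn⟩ := hx
    exact ⟨n, mul_vtx_mem_ghostFiltration hn v⟩
  | mul_edge x e hx =>
    obtain ⟨n, hn⟩ := hx
    exact ⟨n, mul_edg_mem_ghostFiltration (ghostFiltration_mono n.le_succ hn) e⟩
  | mul_ghost x e hx =>
    obtain ⟨n, hn⟩ := hx
    exact ⟨n + 1, mul_gst_mem_ghostFiltration hn e⟩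

/-- Every non-zero element has a non-zero right multiple that is a combination of paths. -/
theorem exists_mul_mem_pathSpan {x : LeavittPathAlgebra G K} (hx : x ≠ 0) :
    ∃ y, x * y ≠ 0 ∧ x * y ∈ pathSpan G K := by
  obtain ⟨n, hn⟩ := exists_mem_ghostFiltration x
  induction n generalizing x with
  | zero =>
    obtain ⟨v, hv⟩ := exists_mul_vtx_ne_zero hx
    exact ⟨_, hv, pathSpan_mul_vtx hn v⟩
  | succ n ih =>
    by_cases hf : ∃ f, x * edg G K f ≠ 0
    · obtain ⟨f, hf⟩ := hf
      obtain ⟨y, hy⟩ := ih hf (mul_edg_mem_ghostFiltration hn f)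
      rw [mul_assoc] at hy
      exact ⟨_, hy⟩
    -- If `x` kills all edges, then `x * v ≠ 0` forces `v` to be a sink: the second Cuntz-Krieger
    -- relation excludes regular vertices, and independence of paths excludes infinite emitters.
    push Not at hf
    obtain ⟨v, hv⟩ := exists_mul_vtx_ne_zero hx
    obtain ⟨β, hβ, s, b, -, hxb⟩ := exists_of_mem_ghostFiltration_succ hn
    by_cases hne : {e : E | G.s e = v}.Nonempty
    · exfalso
      by_cases hfin : {e : E | G.s e = v}.Finite
      · refine hv ?_
        rw [vtx_eq_sum G K v ⟨hfin, hne⟩, Finset.mul_sum]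
        exact Finset.sum_eq_zero fun e _ => by rw [← mul_assoc, hf, zero_mul]
      · obtain ⟨f, hfv : G.s f = v, hfs⟩ := Set.Infinite.exists_notMem_finset hfin s
        have hβv : β * vtx G K v = 0 := by
          rw [← hfv]
          refine mul_vtx_eq_zero_of_mul_edg_eq_zero hβ ?_
          have := hf f
          rwa [hxb, add_mul, Finset.sum_mul, Finset.sum_eq_zero, add_zero] at this
          intro e he
          rw [mul_assoc, gst_mul_edg_of_ne (by rintro rfl; exact hfs he), mul_zero]
        refine hv ?_
        rw [hxb, add_mul, hβv, zero_add, Finset.sum_mul]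
        refine Finset.sum_eq_zero fun e he => ?_
        by_cases hev : G.s e = v
        · have := hf e
          rw [hxb, add_mul, ← vtx_mul_edg, hev, ← mul_assoc, hβv, zero_mul, zero_add, ← hev,
            vtx_mul_edg, Finset.sum_mul, Finset.sum_eq_single e, mul_assoc, gst_mul_edg] at this
          · rw [← vtx_mul_gst, ← mul_assoc, this, zero_mul, zero_mul]
          · exact fun e' _ h => by rw [mul_assoc, gst_mul_edg_of_ne h, mul_zero]
          · exact fun h => absurd he h
        · rw [mul_assoc, gst_mul_vtx_of_ne hev, mul_zero]
    · refine ⟨_, hv, ?_⟩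
      rw [hxb, add_mul, Finset.sum_mul, Finset.sum_eq_zero, add_zero]
      · exact pathSpan_mul_vtx hβ v
      · exact fun e _ => by rw [mul_assoc, gst_mul_vtx_of_ne (fun h => hne ⟨e, h⟩), mul_zero]

/-! ### Reduction to a vertex -/

theorem ghostWalk_mul_ghostWalk {l l' : List E} {w w' : V} (h : w = G.src l' w') :
    ghostWalk G K l' w' * ghostWalk G K l w = ghostWalk G K (l ++ l') w' := by
  induction l with
  | nil => rw [h]; exact ghostWalk_mul_vtx G K l' w'
  | cons e l ih => rw [ghostWalk_cons, ← mul_assoc, ih]; rfl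

/-- Compressing by a path that leaves a closed path through an exit annihilates the closed
path. -/
theorem exists_ghostWalk_mul_eq_zero (hL : G.ConditionL) {c : List E} {v : V} (hc : c ≠ []) :
    ∃ g w, G.IsWalk g w ∧ G.src g w = v ∧
      ghostWalk G K g w * (vtx G K v * walk G K c v) = 0 := by
  by_cases hcv : v = G.src c v ∧ G.IsWalk c v
  · obtain ⟨hv, hw⟩ := hcv
    obtain ⟨l₁, e, l₂, f, hceq, hf, hne⟩ := hL.exists_exit hc hw hv.symm
    have hg : G.IsWalk (l₁ ++ [f]) (G.r f) := by
      rw [hceq, DirectedGraph.isWalk_append] at hw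
      rw [DirectedGraph.isWalk_append]
      exact ⟨(congrArg (G.IsWalk l₁) hf).mpr hw.1, rfl, trivial⟩
    refine ⟨l₁ ++ [f], G.r f, hg, ?_, ?_⟩
    · conv_rhs => rw [hv, hceq]
      rw [DirectedGraph.src_append, DirectedGraph.src_append]
      exact congrArg _ hf
    · conv_lhs => enter [2, 1]; rw [hv]
      rw [vtx_mul_walk]
      refine (ghostWalk_mul_walk hg (by simp [hceq])).resolve_right ?_
      rintro ⟨l'', h, -⟩
      rw [hceq, List.append_assoc, List.append_cancel_left_eq] at h
      exact hne (List.cons.inj h).1.symm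
  · refine ⟨[], v, trivial, rfl, ?_⟩
    by_cases hv : v = G.src c v
    · rw [walk_eq_zero fun h => hcv ⟨hv, h⟩, mul_zero, mul_zero]
    · rw [vtx_mul_walk_of_ne hv, mul_zero]

/-- Finitely many closed paths at `v` can be annihilated at the same time. In the summands,
`vtx v * walk c v` is the closed path `c` if `c` starts at `v`, and zero otherwise. -/
theorem exists_compress_sum_eq_zero (hL : G.ConditionL) {ι : Type*} (s : Finset ι) {v : V}
    {x : ι → LeavittPathAlgebra G K}
    (hx : ∀ i ∈ s, x i = 0 ∨
      ∃ (k : K) (c : List E), c ≠ [] ∧ x i = k • (vtx G K v * walk G K c v)) :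
    ∃ g w, G.IsWalk g w ∧ G.src g w = v ∧
      ghostWalk G K g w * (∑ i ∈ s, x i) * walk G K g w = 0 := by
  classical
  induction s using Finset.induction_on generalizing v x with
  | empty => exact ⟨[], v, trivial, rfl, by simp⟩
  | insert j s hj ih =>
    obtain ⟨g, w, hg, hgv, hgj⟩ : ∃ g w, G.IsWalk g w ∧ G.src g w = v ∧
        ghostWalk G K g w * x j = 0 := by
      rcases hx j (Finset.mem_insert_self j s) with h0 | ⟨k, c, hc, hxj⟩
      · exact ⟨[], v, trivial, rfl, by rw [h0, mul_zero]⟩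
      · obtain ⟨g, w, hg, hgv, hgc⟩ := exists_ghostWalk_mul_eq_zero (K := K) hL (v := v) hc
        exact ⟨g, w, hg, hgv, by rw [hxj, mul_smul_comm, hgc, smul_zero]⟩
    obtain ⟨g', w', hg', hgv', h'⟩ := ih (v := w)
      (x := fun i => ghostWalk G K g w * x i * walk G K g w) (fun i hi => by
        rcases hx i (Finset.mem_insert_of_mem hi) with h0 | ⟨k, c, hc, hxi⟩
        · exact .inl (by simp only [h0, mul_zero, zero_mul])
        have h1 : ghostWalk G K g w * x i * walk G K g w
            = k • (ghostWalk G K g w * walk G K (c ++ g) w) := by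
          rw [hxi, mul_smul_comm, smul_mul_assoc, ← mul_assoc, ← hgv, ghostWalk_mul_vtx, mul_assoc,
            walk_mul_walk rfl]
        rcases ghostWalk_mul_walk (K := K) (l' := c ++ g) (w' := w) hg (by simp) with
          h0 | ⟨c', hc', h0⟩
        · exact .inl (by simp only [h1, h0, smul_zero])
        · refine .inr ⟨k, c', ?_, by simp only [h1, h0]⟩
          rintro rfl
          have := congrArg List.length hc'
          simp [List.length_eq_zero_iff, hc] at this)
    refine ⟨g ++ g', w', ?_, ?_, ?_⟩
    · rw [DirectedGraph.isWalk_append, hgv']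
      exact ⟨hg, hg'⟩
    · rw [DirectedGraph.src_append, hgv', hgv]
    · rw [← Finset.sum_mul, ← Finset.mul_sum] at h'
      rw [Finset.sum_insert hj, ← walk_mul_walk hgv'.symm, ← ghostWalk_mul_ghostWalk hgv'.symm,
        mul_add, mul_assoc _ _ (x j), hgj, mul_zero, zero_add, ← h']
      simp only [mul_assoc]

/-- The Reduction Theorem under Condition (L): every non-zero element can be multiplied, on both
sides, into a non-zero multiple of a vertex. -/
theorem exists_mul_mul_eq_smul_vtx (hL : G.ConditionL) {x : LeavittPathAlgebra G K} (hx : x ≠ 0) :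
    ∃ (a b : LeavittPathAlgebra G K) (k : K) (v : V), k ≠ 0 ∧ a * x * b = k • vtx G K v := by
  classical
  obtain ⟨y, hy0, α, hα⟩ := exists_mul_mem_pathSpan hx
  rw [Finsupp.linearCombination_apply, Finsupp.sum] at hα
  set s := {q ∈ α.support | walk G K q.1 q.2 ≠ 0} with hs
  replace hα : ∑ q ∈ s, α q • walk G K q.1 q.2 = x * y := by
    rw [← hα, hs, Finset.sum_filter_of_ne]
    exact fun q _ h h' => h (by rw [h', smul_zero])
  have hne : s.Nonempty := by
    by_contra h
    rw [Finset.not_nonempty_iff_eq_empty.1 h, Finset.sum_empty] at hα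
    exact hy0 hα.symm
  obtain ⟨⟨l, v⟩, hlv, hmin⟩ := s.exists_min_image (fun q => q.1.length) hne
  obtain ⟨hlα, hl0⟩ := Finset.mem_filter.1 hlv
  have hl : G.IsWalk l v := by
    by_contra h
    exact hl0 (walk_eq_zero h)
  obtain ⟨g, w, hg, hgv, h⟩ := exists_compress_sum_eq_zero (K := K) hL (s.erase (l, v)) (v := v)
    (x := fun q => ghostWalk G K l v * (α q • walk G K q.1 q.2) * vtx G K v) (fun q hq => by
      obtain ⟨hqne, hqs⟩ := Finset.mem_erase.1 hq
      obtain ⟨l', w⟩ := q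
      rw [mul_smul_comm, smul_mul_assoc, mul_assoc]
      by_cases hw : w = v
      · subst hw
        rw [walk_mul_vtx]
        rcases ghostWalk_mul_walk (K := K) (w' := w) hl (hmin _ hqs) with h0 | ⟨c, rfl, hc⟩
        · exact .inl (by rw [h0, smul_zero])
        · exact .inr ⟨α (l ++ c, w), c, by rintro rfl; simp at hqne, by rw [hc]⟩
      · exact .inl (by rw [walk_mul_vtx_of_ne hw, mul_zero, smul_zero]))
  refine ⟨ghostWalk G K g w * ghostWalk G K l v, y * vtx G K v * walk G K g w, α (l, v), w,
    Finsupp.mem_support_iff.1 hlα, ?_⟩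
  have h1 : ghostWalk G K l v * (x * y) * vtx G K v = α (l, v) • vtx G K v +
      ∑ q ∈ s.erase (l, v), ghostWalk G K l v * (α q • walk G K q.1 q.2) * vtx G K v := by
    rw [← hα, ← Finset.add_sum_erase _ _ hlv, mul_add, add_mul, mul_smul_comm,
      ghostWalk_mul_walk_self hl, smul_mul_assoc, vtx_mul_self, Finset.mul_sum, Finset.sum_mul]
  calc _ = ghostWalk G K g w * (ghostWalk G K l v * (x * y) * vtx G K v) * walk G K g w := by
        simp only [mul_assoc]
    _ = _ := by
        rw [h1, mul_add, add_mul, h, add_zero, mul_smul_comm, smul_mul_assoc, ← hgv,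
          ghostWalk_mul_vtx, ghostWalk_mul_walk_self hg]

/-- Under Condition (L), every non-zero `a` has a non-zero `b` with `b a b = b`:
if `p a q = k v`, then `b = k⁻¹ q v p` works. -/
theorem exists_mul_mul_self (hL : G.ConditionL) {a : LeavittPathAlgebra G K} (ha : a ≠ 0) :
    ∃ b, b ≠ 0 ∧ b * a * b = b := by
  obtain ⟨p, q, k, v, hk, h⟩ := exists_mul_mul_eq_smul_vtx hL ha
  have hb : p * a * (k⁻¹ • (q * vtx G K v * p)) * a * q = k • vtx G K v := by
    calc _ = k⁻¹ • (p * a * q * vtx G K v * (p * a * q)) := by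
          simp only [mul_smul_comm, smul_mul_assoc, mul_assoc]
      _ = _ := by
          simp only [h, smul_mul_assoc, mul_smul_comm, vtx_mul_self, inv_smul_smul₀ hk]
  refine ⟨k⁻¹ • (q * vtx G K v * p), fun h0 => ?_, ?_⟩
  · rw [h0, mul_zero, zero_mul, zero_mul] at hb
    exact (smul_ne_zero hk (vtx_ne_zero G K v)) hb.symm
  · calc _ = k⁻¹ • k⁻¹ • (q * vtx G K v * (p * a * q) * vtx G K v * p) := by
          simp only [mul_smul_comm, smul_mul_assoc, mul_assoc]
      _ = _ := by
          simp only [h, smul_mul_assoc, mul_smul_comm, vtx_mul_self, inv_smul_smul₀ hk, mul_assoc]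

end Reduction

end LeavittPathAlgebra

/-! ### The corner at a cycle without exits -/

namespace DirectedGraph

variable {V E : Type*} (G : DirectedGraph V E)

/-- The sequence `c` runs periodically through the `N` edges of a simple closed path without
exits; it passes through its base at the multiples of `N` only. -/
structure IsNoExitCycle (c : ℕ → E) (N : ℕ) : Prop where
  pos : 0 < N
  path : ∀ i, G.r (c i) = G.s (c (i + 1))
  periodic : ∀ i, c (i + N) = c i
  base : ∀ i, G.s (c i) = G.s (c 0) → N ∣ i
  noExit : ∀ i f, G.s f = G.s (c i) → f = c i

variable {G}

theorem exists_isNoExitCycle (h : ¬ G.ConditionL) : ∃ c N, G.IsNoExitCycle c N := by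
  unfold ConditionL at h
  push Not at h
  obtain ⟨n, e, ⟨⟨hp, hcl⟩, hs⟩, hno⟩ := h
  have hval (i : ℕ) : ((Fin.ofNat (n + 1) i : Fin (n + 1)) : ℕ) = i % (n + 1) := rfl
  refine ⟨fun i => e (Fin.ofNat (n + 1) i), n + 1, n.succ_pos, fun i => ?_, fun i => ?_,
    fun i hi => ?_, fun i f hf => ?_⟩
  · have hlt := Nat.mod_lt i n.succ_pos
    by_cases hi : i % (n + 1) = n
    · have h1 : Fin.ofNat (n + 1) i = Fin.last n := Fin.ext hi
      have h2 : Fin.ofNat (n + 1) (i + 1) = 0 := by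
        apply Fin.ext
        rw [hval, Nat.add_mod, hi]
        rcases n with _ | n
        · simp
        · rw [Nat.mod_eq_of_lt (a := 1) (by omega), Nat.mod_self]; rfl
      simp only [h1, h2, hcl]
    · have hlt' : i % (n + 1) < n := lt_of_le_of_ne (Nat.le_of_lt_succ hlt) hi
      have h1 : Fin.ofNat (n + 1) i = (⟨i % (n + 1), hlt'⟩ : Fin n).castSucc := Fin.ext rfl
      have h2 : Fin.ofNat (n + 1) (i + 1) = (⟨i % (n + 1), hlt'⟩ : Fin n).succ := by
        apply Fin.ext
        rw [hval, Nat.add_mod, Fin.val_succ, Nat.mod_eq_of_lt (a := 1) (by omega),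
          Nat.mod_eq_of_lt (by omega)]
      simp only [h1, h2]
      exact hp _
  · congr 1
    apply Fin.ext
    rw [hval, hval, Nat.add_mod_right]
  · by_contra hdvd
    refine hs (Fin.ofNat (n + 1) i) (fun h0 => hdvd ?_) hi
    exact Nat.dvd_of_mod_eq_zero (congrArg Fin.val h0)
  · by_contra hne
    exact hno f ⟨_, hf, hne⟩

theorem IsNoExitCycle.s_period {c : ℕ → E} {N : ℕ} (hc : G.IsNoExitCycle c N) :
    G.s (c N) = G.s (c 0) := by
  rw [← hc.periodic 0, zero_add]

/-- The vertices on the cycle are distinct: without exits a vertex determines all later edges, so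
two positions at the same vertex reach the base at the same time. -/
theorem IsNoExitCycle.eq_of_s_eq {c : ℕ → E} {N : ℕ} (hc : G.IsNoExitCycle c N) {i j : ℕ}
    (hi : i < N) (hj : j < N) (h : G.s (c i) = G.s (c j)) : i = j := by
  have key (k : ℕ) : G.s (c (i + k)) = G.s (c (j + k)) := by
    induction k with
    | zero => exact h
    | succ k ih =>
      rw [← add_assoc, ← add_assoc, ← hc.path, ← hc.path, hc.noExit _ _ ih]
  have h' := key (N - i)
  rw [Nat.add_sub_cancel' hi.le, hc.s_period] at h'
  obtain ⟨m, hm⟩ := hc.base _ h'.symm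
  obtain rfl : m = 1 := by
    have h1 : 0 < m := Nat.pos_of_ne_zero (by rintro rfl; omega)
    have h2 : m < 2 := by
      by_contra hm2
      have := Nat.mul_le_mul_left N (not_lt.1 hm2)
      omega
    omega
  omega

end DirectedGraph

namespace LeavittPathAlgebra

section Cycle

variable {V E : Type*} (G : DirectedGraph V E) (K : Type*) [Field K] (c : ℕ → E)

/-- The path with the edges `c 0, …, c (i - 1)`. -/
noncomputable def initial : ℕ → LeavittPathAlgebra G K
  | 0 => vtx G K (G.s (c 0))
  | i + 1 => initial i * edg G K (c i)

/-- The ghost path of `initial G K c i`. -/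
noncomputable def initialGhost : ℕ → LeavittPathAlgebra G K
  | 0 => vtx G K (G.s (c 0))
  | i + 1 => gst G K (c i) * initialGhost i

variable {G c} {N : ℕ}

theorem vtx_mul_initial (i : ℕ) : vtx G K (G.s (c 0)) * initial G K c i = initial G K c i := by
  induction i with
  | zero => exact vtx_mul_self G K _
  | succ i ih => rw [initial, ← mul_assoc, ih]

theorem initialGhost_mul_vtx (i : ℕ) :
    initialGhost G K c i * vtx G K (G.s (c 0)) = initialGhost G K c i := by
  induction i with
  | zero => exact vtx_mul_self G K _
  | succ i ih => rw [initialGhost, mul_assoc, ih]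

theorem initial_eq_walk (hc : G.IsNoExitCycle c N) (i : ℕ) :
    initial G K c i = walk G K ((List.range i).map c) (G.s (c i)) := by
  induction i with
  | zero => rfl
  | succ i ih =>
    rw [initial, ih, walk_mul_edg, List.range_succ, List.map_append, hc.path]
    rfl

theorem isWalk_initial (hc : G.IsNoExitCycle c N) (i : ℕ) :
    G.IsWalk ((List.range i).map c) (G.s (c i)) := by
  induction i with
  | zero => trivial
  | succ i ih =>
    rw [List.range_succ, List.map_append, DirectedGraph.isWalk_append]
    exact ⟨ih, hc.path i, trivial⟩

theorem initial_mul_vtx (hc : G.IsNoExitCycle c N) (i : ℕ) :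
    initial G K c i * vtx G K (G.s (c i)) = initial G K c i := by
  rw [initial_eq_walk K hc, walk_mul_vtx]

theorem vtx_mul_initialGhost (hc : G.IsNoExitCycle c N) (i : ℕ) :
    vtx G K (G.s (c i)) * initialGhost G K c i = initialGhost G K c i := by
  cases i with
  | zero => exact vtx_mul_self G K _
  | succ i => rw [initialGhost, ← mul_assoc, ← hc.path, vtx_mul_gst]

theorem edg_mul_gst (hc : G.IsNoExitCycle c N) (i : ℕ) :
    edg G K (c i) * gst G K (c i) = vtx G K (G.s (c i)) := by
  have hset : {e : E | G.s e = G.s (c i)} = {c i} :=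
    Set.eq_singleton_iff_unique_mem.2 ⟨rfl, fun f hf => hc.noExit i f hf⟩
  have hreg : G.IsRegularVertex (G.s (c i)) := by
    rw [DirectedGraph.IsRegularVertex, hset]
    exact ⟨Set.finite_singleton _, Set.singleton_nonempty _⟩
  rw [vtx_eq_sum G K _ hreg, Finset.sum_eq_single (c i)]
  · intro f hf hne
    exact absurd (hc.noExit i f (by simpa using hf)) hne
  · intro h
    exact absurd (by simp) h

theorem initial_mul_initialGhost (hc : G.IsNoExitCycle c N) (i : ℕ) :
    initial G K c i * initialGhost G K c i = vtx G K (G.s (c 0)) := by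
  induction i with
  | zero => exact vtx_mul_self G K _
  | succ i ih =>
    rw [initial, initialGhost, mul_assoc, ← mul_assoc (edg G K _), edg_mul_gst K hc,
      vtx_mul_initialGhost K hc, ih]

theorem initialGhost_mul_initial (hc : G.IsNoExitCycle c N) (i : ℕ) :
    initialGhost G K c i * initial G K c i = vtx G K (G.s (c i)) := by
  induction i with
  | zero => exact vtx_mul_self G K _
  | succ i ih =>
    rw [initial, initialGhost, mul_assoc, ← mul_assoc (initialGhost G K c i), ih, vtx_mul_edg,
      gst_mul_edg, hc.path]

theorem initial_add_period (hc : G.IsNoExitCycle c N) (i : ℕ) :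
    initial G K c (i + N) = initial G K c N * initial G K c i := by
  induction i with
  | zero => rw [zero_add, initial, ← hc.s_period, initial_mul_vtx K hc]
  | succ i ih => rw [add_right_comm, initial, ih, hc.periodic, initial, mul_assoc]

theorem initialGhost_add_period (hc : G.IsNoExitCycle c N) (i : ℕ) :
    initialGhost G K c (i + N) = initialGhost G K c i * initialGhost G K c N := by
  induction i with
  | zero =>
    rw [zero_add, initialGhost]
    conv_rhs => rw [← hc.s_period, vtx_mul_initialGhost K hc]
  | succ i ih => rw [add_right_comm, initialGhost, ih, hc.periodic, initialGhost, mul_assoc]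

variable (G) in
theorem isIdempotentElem_vtx (v : V) : IsIdempotentElem (vtx G K v) := vtx_mul_self G K v

/-- The cycle, as a unit of the corner at its base. -/
noncomputable def cycleUnit (hc : G.IsNoExitCycle c N) :
    (IsIdempotentElem.Corner (isIdempotentElem_vtx G K (G.s (c 0))))ˣ where
  val := ⟨initial G K c N, (Subsemigroup.mem_corner_iff (isIdempotentElem_vtx G K _)).2
    ⟨vtx_mul_initial K N, hc.s_period ▸ initial_mul_vtx K hc N⟩⟩
  inv := ⟨initialGhost G K c N, (Subsemigroup.mem_corner_iff (isIdempotentElem_vtx G K _)).2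
    ⟨hc.s_period ▸ vtx_mul_initialGhost K hc N, initialGhost_mul_vtx K N⟩⟩
  val_inv := Subtype.ext (initial_mul_initialGhost K hc N)
  inv_val := Subtype.ext ((initialGhost_mul_initial K hc N).trans (by rw [hc.s_period]; rfl))

/-- The homomorphism from the Laurent polynomials to `L_K(G)` that takes the variable to the
cycle, and `1` to its base. -/
noncomputable def laurentHom (hc : G.IsNoExitCycle c N) :
    LaurentPolynomial K →ₙₐ[K] LeavittPathAlgebra G K :=
  AddMonoidAlgebra.liftMagma K
    { toFun := fun m => ((cycleUnit K hc ^ m.toAdd :) :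
        IsIdempotentElem.Corner (isIdempotentElem_vtx G K (G.s (c 0)))).1
      map_mul' := fun m n => by
        rw [toAdd_mul, zpow_add]
        rfl }

theorem laurentHom_single (hc : G.IsNoExitCycle c N) (m : ℤ) (k : K) :
    laurentHom K hc (.single m k) = k • ((cycleUnit K hc ^ m :) :
        IsIdempotentElem.Corner (isIdempotentElem_vtx G K (G.s (c 0)))).1 := by
  simp [laurentHom, -LaurentPolynomial.single_eq_C_mul_T]

theorem laurentHom_one (hc : G.IsNoExitCycle c N) :
    laurentHom K hc 1 = vtx G K (G.s (c 0)) := by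
  rw [← LaurentPolynomial.single_zero_one_eq_one, laurentHom_single, one_smul, zpow_zero]
  rfl

theorem laurentHom_T_one (hc : G.IsNoExitCycle c N) :
    laurentHom K hc (LaurentPolynomial.T 1) = initial G K c N := by
  rw [LaurentPolynomial.T, laurentHom_single, one_smul, zpow_one]
  rfl

theorem laurentHom_T_neg_one (hc : G.IsNoExitCycle c N) :
    laurentHom K hc (LaurentPolynomial.T (-1)) = initialGhost G K c N := by
  rw [LaurentPolynomial.T, laurentHom_single, one_smul, zpow_neg_one]
  rfl

theorem laurentHom_T_natCast (hc : G.IsNoExitCycle c N) (m : ℕ) :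
    laurentHom K hc (LaurentPolynomial.T m) = initial G K c (m * N) := by
  induction m with
  | zero => rw [zero_mul, Nat.cast_zero, LaurentPolynomial.T_zero, laurentHom_one]; rfl
  | succ m ih =>
    rw [Nat.cast_succ, add_comm, LaurentPolynomial.T_add, map_mul, ih, laurentHom_T_one,
      ← initial_add_period K hc, add_mul, one_mul]

theorem laurentHom_injective (hc : G.IsNoExitCycle c N) :
    Function.Injective (laurentHom K hc) := by
  rw [injective_iff_map_eq_zero]
  intro q hq
  obtain ⟨n, p, hp⟩ := q.exists_T_pow
  have hcoef (k : ℕ) (p : Polynomial K) :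
      coef G K ((List.range (k * N)).map c, G.s (c (k * N))) (laurentHom K hc p.toLaurent)
        = p.coeff k := by
    induction p using Polynomial.induction_on' with
    | add p q hp hq => rw [map_add, map_add, map_add, hp, hq, Polynomial.coeff_add]
    | monomial m a =>
      rw [← Polynomial.C_mul_X_pow_eq_monomial, Polynomial.toLaurent_C_mul_X_pow,
        ← LaurentPolynomial.smul_eq_C_mul, map_smul, laurentHom_T_natCast, initial_eq_walk K hc,
        map_smul, Polynomial.coeff_C_mul_X_pow]
      by_cases hmk : k = m
      · subst hmk
        rw [coef_walk_self (q := ((List.range (k * N)).map c, G.s (c (k * N))))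
          (isWalk_initial hc _), if_pos rfl, smul_eq_mul, mul_one]
      · rw [coef_walk_of_ne (q := ((List.range (k * N)).map c, G.s (c (k * N))))
          (q' := ((List.range (m * N)).map c, G.s (c (m * N)))) (isWalk_initial hc _),
          if_neg hmk, smul_zero]
        intro h
        have := congrArg (fun x => x.1.length) h
        simp only [List.length_map, List.length_range] at this
        exact hmk (Nat.eq_of_mul_eq_mul_right hc.pos this.symm)
  have hp0 : p = 0 := by
    ext k
    rw [← hcoef k p, hp, map_mul, hq, zero_mul, map_zero, Polynomial.coeff_zero]
  rw [hp0, map_zero] at hp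
  exact ((LaurentPolynomial.isUnit_T n).mul_left_eq_zero).1 hp.symm

theorem initial_mul_initialGhost_mem (hc : G.IsNoExitCycle c N) (i j : ℕ)
    (h : G.s (c i) = G.s (c j)) :
    initial G K c i * initialGhost G K c j ∈ NonUnitalAlgHom.range (laurentHom K hc) := by
  induction i using Nat.strong_induction_on generalizing j with | _ i ihi
  by_cases hi : N ≤ i
  · obtain ⟨i, rfl⟩ := Nat.exists_eq_add_of_le' hi
    rw [hc.periodic] at h
    obtain ⟨q, hq⟩ := ihi i (by have := hc.pos; omega) j h
    refine ⟨LaurentPolynomial.T 1 * q, ?_⟩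
    rw [initial_add_period K hc, mul_assoc, ← hq, ← laurentHom_T_one K hc]
    exact map_mul (laurentHom K hc) _ _
  clear ihi
  induction j using Nat.strong_induction_on with | _ j ihj
  by_cases hj : N ≤ j
  · obtain ⟨j, rfl⟩ := Nat.exists_eq_add_of_le' hj
    rw [hc.periodic] at h
    obtain ⟨q, hq⟩ := ihj j (by have := hc.pos; omega) h
    refine ⟨q * LaurentPolynomial.T (-1), ?_⟩
    rw [initialGhost_add_period K hc, ← mul_assoc, ← hq, ← laurentHom_T_neg_one K hc]
    exact map_mul (laurentHom K hc) _ _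
  obtain rfl := hc.eq_of_s_eq (not_le.1 hi) (not_le.1 hj) h
  exact ⟨1, (laurentHom_one K hc).trans (initial_mul_initialGhost K hc i).symm⟩

/-- A path from the base cannot leave the cycle. -/
theorem initial_mul_mul_initialGhost_mem (hc : G.IsNoExitCycle c N)
    {x : LeavittPathAlgebra G K} (hx : x ∈ pathSpan G K) (i j : ℕ) :
    initial G K c i * x * initialGhost G K c j ∈
      NonUnitalAlgHom.range (laurentHom K hc) := by
  refine pathSpan_induction (p := fun x => initial G K c i * x * initialGhost G K c j ∈
    NonUnitalAlgHom.range (laurentHom K hc)) ?_ (fun l w => ?_) (fun x y hx hy => ?_)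
    (fun k x hx => ?_) hx
  · rw [mul_zero, zero_mul]; exact zero_mem _
  · induction l generalizing i with
    | nil =>
      by_cases hi : G.s (c i) = w
      · by_cases hj : w = G.s (c j)
        · rw [walk_nil, ← hi, initial_mul_vtx K hc]
          exact initial_mul_initialGhost_mem K hc i j (hi.trans hj)
        · rw [walk_nil, mul_assoc, ← vtx_mul_initialGhost K hc, ← mul_assoc (vtx G K w),
            vtx_mul_of_ne hj, zero_mul, mul_zero]
          exact zero_mem _
      · rw [walk_nil, ← initial_mul_vtx K hc, mul_assoc (initial G K c i), vtx_mul_of_ne hi,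
          mul_zero, zero_mul]
        exact zero_mem _
    | cons e l ih =>
      rw [walk_cons, ← mul_assoc]
      by_cases he : G.s e = G.s (c i)
      · rw [hc.noExit i e he]
        exact ih (i + 1)
      · rw [← initial_mul_vtx K hc, mul_assoc (initial G K c i), vtx_mul_edg_of_ne (Ne.symm he),
          mul_zero, zero_mul, zero_mul]
        exact zero_mem _
  · rw [mul_add, add_mul]; exact add_mem hx hy
  · rw [mul_smul_comm, smul_mul_assoc]; exact SMulMemClass.smul_mem k hx

/-- The corner at the base of a cycle without exits consists of Laurent polynomials in the
cycle. -/
theorem exists_laurentHom_eq (hc : G.IsNoExitCycle c N) (x : LeavittPathAlgebra G K) :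
    ∃ q, laurentHom K hc q = vtx G K (G.s (c 0)) * x * vtx G K (G.s (c 0)) := by
  obtain ⟨n, hn⟩ := exists_mem_ghostFiltration x
  suffices h : ∀ j, initial G K c 0 * x * initialGhost G K c j ∈
      NonUnitalAlgHom.range (laurentHom K hc) from h 0
  induction n generalizing x with
  | zero => exact initial_mul_mul_initialGhost_mem K hc hn 0
  | succ n ih =>
    intro j
    obtain ⟨β, hβ, s, b, hb, rfl⟩ := exists_of_mem_ghostFiltration_succ hn
    rw [mul_add, add_mul, Finset.mul_sum, Finset.sum_mul]
    refine add_mem (initial_mul_mul_initialGhost_mem K hc hβ 0 j) (sum_mem fun e _ => ?_)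
    rw [← mul_assoc, mul_assoc]
    by_cases he : G.s e = G.s (c j)
    · rw [hc.noExit j e he]
      exact ih (b (c j)) (hb _) (j + 1)
    · rw [← vtx_mul_initialGhost K hc, ← mul_assoc (gst G K e), gst_mul_vtx_of_ne he, zero_mul,
        mul_zero]
      exact zero_mem _

/-- If Condition (L) fails, there is a non-nilpotent `a` such that neither `a L` nor `L a`
contains a non-zero idempotent: the sum of a cycle without exits and its base, which corresponds to
the Laurent polynomial `1 + T`. -/
theorem exists_forall_isIdempotentElem_eq_zero (hL : ¬ G.ConditionL) :
    ∃ a u : LeavittPathAlgebra G K, a * u = a ∧ u * a = a ∧ (∀ n, powSucc a n ≠ 0) ∧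
      (∀ b, IsIdempotentElem (a * b) → a * b = 0) ∧
      ∀ b, IsIdempotentElem (b * a) → b * a = 0 := by
  obtain ⟨c, N, hc⟩ := DirectedGraph.exists_isNoExitCycle hL
  set u := vtx G K (G.s (c 0)) with hu
  have hu1 : laurentHom K hc 1 = u := laurentHom_one K hc
  set p : LaurentPolynomial K := 1 + LaurentPolynomial.T 1 with hp
  have hp0 : p ≠ 0 := by
    intro h
    have := congrArg (fun q => q.coeff 0) h
    simp [hp, ← LaurentPolynomial.T_zero] at this
  -- The only idempotents of a domain are `0` and `1`, and `p` is not a unit since it vanishes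
  -- at `-1`.
  have key (q : LaurentPolynomial K)
      (hq : IsIdempotentElem (laurentHom K hc (p * q))) : laurentHom K hc (p * q) = 0 := by
    have hpq : IsIdempotentElem (p * q) := laurentHom_injective K hc (by rw [map_mul]; exact hq)
    rcases IsIdempotentElem.iff_eq_zero_or_one.1 hpq with h | h
    · rw [h, map_zero]
    · have := congrArg (LaurentPolynomial.eval₂ (RingHom.id K) (-1)) h
      rw [map_mul, map_one, hp, map_add, map_one, LaurentPolynomial.eval₂_T] at this
      simp at this
  have hau : laurentHom K hc p * u = laurentHom K hc p := by rw [← hu1, ← map_mul, mul_one]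
  have hua : u * laurentHom K hc p = laurentHom K hc p := by rw [← hu1, ← map_mul, one_mul]
  refine ⟨laurentHom K hc p, u, hau, hua, fun n => ?_, fun b hb => ?_, fun b hb => ?_⟩
  · have : powSucc (laurentHom K hc p) n = laurentHom K hc (p ^ (n + 1)) := by
      induction n with
      | zero => rw [zero_add, pow_one]; rfl
      | succ n ih => rw [powSucc, ih, pow_succ p (n + 1), map_mul]
    rw [this, Ne, map_eq_zero_iff _ (laurentHom_injective K hc)]
    exact pow_ne_zero _ hp0
  · obtain ⟨q, hq⟩ := exists_laurentHom_eq K hc b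
    have hpq : laurentHom K hc (p * q) = laurentHom K hc p * b * u := by
      rw [map_mul, hq, ← hu, ← mul_assoc, ← mul_assoc, hau]
    have h0 : laurentHom K hc p * b * u = 0 := by
      rw [← hpq]
      refine key q ?_
      rw [hpq]
      calc _ = laurentHom K hc p * b * (u * laurentHom K hc p) * b * u := by simp only [mul_assoc]
        _ = laurentHom K hc p * b * (laurentHom K hc p * b) * u := by
            rw [hua]
            simp only [mul_assoc]
        _ = _ := by rw [hb.eq]
    calc _ = laurentHom K hc p * b * (laurentHom K hc p * b) := hb.eq.symm
      _ = laurentHom K hc p * b * u * laurentHom K hc p * b := by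
        rw [mul_assoc _ u, hua]
        simp only [mul_assoc]
      _ = _ := by rw [h0, zero_mul, zero_mul]
  · obtain ⟨q, hq⟩ := exists_laurentHom_eq K hc b
    have hpq : laurentHom K hc (p * q) = u * b * laurentHom K hc p := by
      rw [mul_comm, map_mul, hq, ← hu, mul_assoc, hua]
    have h0 : u * b * laurentHom K hc p = 0 := by
      rw [← hpq]
      refine key q ?_
      rw [hpq]
      calc _ = u * b * (laurentHom K hc p * u) * b * laurentHom K hc p := by simp only [mul_assoc]
        _ = u * (b * laurentHom K hc p * (b * laurentHom K hc p)) := by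
            rw [hau]
            simp only [mul_assoc]
        _ = _ := by rw [hb.eq, mul_assoc]
    calc _ = b * laurentHom K hc p * (b * laurentHom K hc p) := hb.eq.symm
      _ = b * (laurentHom K hc p * u) * b * laurentHom K hc p := by rw [hau]; simp only [mul_assoc]
      _ = b * laurentHom K hc p * (u * b * laurentHom K hc p) := by simp only [mul_assoc]
      _ = _ := by rw [h0, mul_zero]

end Cycle

end LeavittPathAlgebra

/-! ### The equivalence -/

open LeavittPathAlgebra in
theorem theorem1 {V E : Type*} (G : DirectedGraph V E) (K : Type*) [Field K] :
    List.TFAE [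
      IsZornRing (LeavittPathAlgebra G K),
      ∀ I : AddSubgroup (LeavittPathAlgebra G K), IsRightIdeal I ∨ IsLeftIdeal I → I ≠ ⊥ →
        ∃ u ∈ I, u ≠ 0 ∧ IsIdempotentElem u,
      ∀ I : AddSubgroup (LeavittPathAlgebra G K), IsRightIdeal I → I ≠ ⊥ →
        ∃ u ∈ I, u ≠ 0 ∧ IsIdempotentElem u,
      ∀ I : AddSubgroup (LeavittPathAlgebra G K), IsLeftIdeal I → I ≠ ⊥ →
        ∃ u ∈ I, u ≠ 0 ∧ IsIdempotentElem u,
      ∀ a : LeavittPathAlgebra G K, a ≠ 0 →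
        ∃ b : LeavittPathAlgebra G K, b ≠ 0 ∧ b * a * b = b,
      G.ConditionL] := by
  have idem {a b : LeavittPathAlgebra G K} (hb : b ≠ 0) (h : b * a * b = b) :
      (a * b ≠ 0 ∧ IsIdempotentElem (a * b)) ∧ b * a ≠ 0 ∧ IsIdempotentElem (b * a) := by
    refine ⟨⟨fun h0 => hb ?_, ?_⟩, fun h0 => hb ?_, ?_⟩
    · rw [← h, mul_assoc, h0, mul_zero]
    · rw [IsIdempotentElem, mul_assoc, ← mul_assoc b, h]
    · rw [← h, h0, zero_mul]
    · rw [IsIdempotentElem, ← mul_assoc, h]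
  tfae_have 6 → 5 := fun hL a ha => exists_mul_mul_self hL ha
  tfae_have 5 → 2 := fun h I hI hne => by
    obtain ⟨a, haI, ha⟩ := I.bot_or_exists_ne_zero.resolve_left hne
    obtain ⟨b, hb, hbab⟩ := h a ha
    rcases hI with hI | hI
    · exact ⟨_, hI a haI b, (idem hb hbab).1⟩
    · exact ⟨_, hI a haI b, (idem hb hbab).2⟩
  tfae_have 2 → 3 := fun h I hI => h I (.inl hI)
  tfae_have 2 → 4 := fun h I hI => h I (.inr hI)
  tfae_have 5 → 1 := fun h a => by
    by_cases ha : a = 0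
    · exact .inl ⟨0, ha⟩
    · obtain ⟨b, hb, hbab⟩ := h a ha
      exact .inr ⟨b, (idem hb hbab).1⟩
  tfae_have 1 → 6 := fun h => by
    by_contra hL
    obtain ⟨a, u, -, -, hnil, hr, -⟩ := exists_forall_isIdempotentElem_eq_zero K hL
    rcases h a with ⟨n, hn⟩ | ⟨b, hb, hab⟩
    · exact hnil n hn
    · exact hb (hr b hab)
  tfae_have 3 → 6 := fun h => by
    by_contra hL
    obtain ⟨a, u, hau, -, hnil, hr, -⟩ := exists_forall_isIdempotentElem_eq_zero K hL
    obtain ⟨_, ⟨b, rfl⟩, hb, hab⟩ := h (AddMonoidHom.mulLeft a).range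
      (by rintro _ ⟨b, rfl⟩ x; exact ⟨b * x, (mul_assoc a b x).symm⟩)
      (fun hbot => hnil 0 ((AddSubgroup.mem_bot).1 (hbot ▸ ⟨u, hau⟩)))
    exact hb (hr b hab)
  tfae_have 4 → 6 := fun h => by
    by_contra hL
    obtain ⟨a, u, -, hua, hnil, -, hl⟩ := exists_forall_isIdempotentElem_eq_zero K hL
    obtain ⟨_, ⟨b, rfl⟩, hb, hab⟩ := h (AddMonoidHom.mulRight a).range
      (by rintro _ ⟨b, rfl⟩ x; exact ⟨x * b, mul_assoc x b a⟩)
      (fun hbot => hnil 0 ((AddSubgroup.mem_bot).1 (hbot ▸ ⟨u, hua⟩)))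
    exact hb (hl b hab)
  tfae_finish
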